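/- All Hilbert spaces are finite-dimensional; $\mathcal L(X)$ denotes the linear operators on system $X$; $D(\rho,\sigma)=\frac12\operatorname{tr}\sqrt{(\rho-\sigma)^\dagger(\rho-\sigma)}$ is the trace distance. For linear maps $\Phi,\Psi$ on $\mathcal L(X)$ write $\Phi\approx_\varepsilon\Psi$ if $D\big((\Phi\otimes\mathrm{id}_R)(\rho),(\Psi\otimes\mathrm{id}_R)(\rho)\big)\le\varepsilon$ for all reference systems $R$ and all normalized states $\rho$ of $XR$ (i.e. $\frac12\|\Phi-\Psi\|_\diamond\le\varepsilon$). **Setting.** The delegated computation is a completely positive trace-preserving (CPTP) map $\mathcal U:\mathcal L(A)\to\mathcal L(A)$ on Alice's register $A$. A unit vector $|\mathrm{err}\rangle\in\mathcal H_A$, orthogonal to all outputs of $\mathcal U$, serves as error flag, and $\mathcal E^{\mathrm{err}}(\rho)=\operatorname{tr}(\rho)\,|\mathrm{err}\rangle\langle\mathrm{err}|$. The permitted leak is a fixed classical value. Alice's part $\pi_A$ of a delegated quantum computation (DQC) protocol is a sequence of CPTP maps $\mathcal E_1,\dots,\mathcal E_N$ on $\mathcal L(AC)$, where $C$ is the communication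 channel, initially in a fixed state $|0\rangle$: Alice applies $\mathcal E_1$ and sends $C$ to the server Bob, applies $\mathcal E_2$ when $C$ is returned, and so on; after $\mathcal E_N$ the final content of $A$ is her output. A cheating Bob with register $B$ applies arbitrary CPTP maps $\mathcal F_1,\dots,\mathcal F_{N-1}$ on $\mathcal L(CB)$ between Alice's maps; the resulting map is $\mathcal P_{AB}:\mathcal L(AB)\to\mathcal L(AB)$. **Stand-alone $\varepsilon$-blind verifiability.** For every register $B$ and all CPTP maps $\{\mathcal F_i\}$ there are completely positive trace non-increasing maps $\mathcal F^{\mathrm{ok}},\mathcal F^{\mathrm{err}}:\mathcal L(B)\to\mathcal L(B)$ with $$\mathcal P_{AB}\approx_\varepsilon \mathcal U\otimes\mathcal F^{\mathrm{ok}}+\mathcal E^{\mathrm{err}}\otimes\mathcal F^{\mathrm{err}} .$$ **(Composable) $\varepsilon$-security.** The ideal resource $\mathscr S^{bv}$ takes Alice's input $\psi_A$ and a bit $b$ from Bob's interface. If $b=0$, it outputs $\mathcal U(\psi_A)$ to Alice. If $b=1$, it outputs the leak at Bob's interface, reads a bit $c$ there, and outputs to Alice $\mathcal U(\psi_A)$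 if $c=0$ and $|\mathrm{err}\rangle\langle\mathrm{err}|$ if $c=1$. A simulator $\sigma_B$ is a quantum system with memory that supplies $b$, receives the leak if $b=1$, then exchanges messages on $C$ with the outside like $\pi_A$ does (it sends $N-1$ messages and receives a reply to each), and finally supplies $c$. The protocol is $\varepsilon$-secure if there is a simulator $\sigma_B$ such that the interactive systems ($N$-combs) $\pi_A\mathscr R$ ($\pi_A$ plugged into the channel) and $\mathscr S^{bv}\sigma_B$ are $\varepsilon$-indistinguishable: for every register $R$, every normalized input state of $AR$ and all CPTP maps $\mathcal D_1,\dots,\mathcal D_{N-1}$ on $\mathcal L(CR)$ that a distinguisher applies to the messages and its register, the two final states of $AR$ have trace distance at most $\varepsilon$. **Theorem.** Every DQC protocol which provides stand-alone $\varepsilon$-blind verifiability is $2\varepsilon$-secure. Conversely, every DQC protocol which is $\varepsilon$-secure provides stand-alone $\varepsilon$-blind verifiability. -/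

import Mathlib

open scoped MatrixOrder ComplexOrder Kronecker

noncomputable section

namespace DQC

/-! ### Finite-dimensional quantum theory

A finite-dimensional system is given by a finite type `I` labelling an orthonormal basis of its
Hilbert space, and the composite of the systems `I` and `J` is `I × J`. -/

/-- Linear operators on the Hilbert space `ℂ^I`. -/
abbrev Op (I : Type) := Matrix I I ℂ

/-- Density operators (normalized states). -/
def IsState {I : Type} [Fintype I] (ρ : Op I) : Prop :=
  ρ.PosSemidef ∧ ρ.trace = 1

/-- The trace norm `tr √(M† M)`. -/
def traceNorm {I : Type} [Fintype I] [DecidableEq I] (M : Op I) : ℝ :=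
  (Matrix.trace (CFC.sqrt (M.conjTranspose * M))).re

/-- The trace distance. -/
def traceDist {I : Type} [Fintype I] [DecidableEq I] (ρ σ : Op I) : ℝ :=
  traceNorm (ρ - σ) / 2

/-- The map `Φ ⊗ id_K`. -/
def tensorId {I J : Type} (Φ : Op I →ₗ[ℂ] Op J) (K : Type) : Op (I × K) →ₗ[ℂ] Op (J × K) where
  toFun ρ := Matrix.of fun p q => Φ (Matrix.of fun i i' => ρ (i, p.2) (i', q.2)) p.1 q.1
  map_add' ρ σ := by
    ext p q
    exact congrFun (congrFun (Φ.map_add (Matrix.of fun i i' => ρ (i, p.2) (i', q.2))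
      (Matrix.of fun i i' => σ (i, p.2) (i', q.2))) p.1) q.1
  map_smul' c ρ := by
    ext p q
    exact congrFun (congrFun (Φ.map_smul c (Matrix.of fun i i' => ρ (i, p.2) (i', q.2))) p.1) q.1

/-- The map `id_K ⊗ Φ`. -/
def idTensor {I J : Type} (K : Type) (Φ : Op I →ₗ[ℂ] Op J) : Op (K × I) →ₗ[ℂ] Op (K × J) where
  toFun ρ := Matrix.of fun p q => Φ (Matrix.of fun i i' => ρ (p.1, i) (q.1, i')) p.2 q.2
  map_add' ρ σ := by
    ext p q
    exact congrFun (congrFun (Φ.map_add (Matrix.of fun i i' => ρ (p.1, i) (q.1, i'))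
      (Matrix.of fun i i' => σ (p.1, i) (q.1, i'))) p.2) q.2
  map_smul' c ρ := by
    ext p q
    exact congrFun (congrFun (Φ.map_smul c (Matrix.of fun i i' => ρ (p.1, i) (q.1, i'))) p.2) q.2

/-- The map `Φ ⊗ Ψ`. -/
def tensorMap {I J K L : Type} (Φ : Op I →ₗ[ℂ] Op J) (Ψ : Op K →ₗ[ℂ] Op L) :
    Op (I × K) →ₗ[ℂ] Op (J × L) :=
  tensorId Φ L ∘ₗ idTensor I Ψ

/-- The canonical identification `(I ⊗ J) ⊗ K = I ⊗ (J ⊗ K)`. -/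
def assoc (I J K : Type) : Op ((I × J) × K) ≃ₗ[ℂ] Op (I × (J × K)) :=
  Matrix.reindexLinearEquiv ℂ ℂ (Equiv.prodAssoc I J K) (Equiv.prodAssoc I J K)

/-- The partial trace over the second factor. -/
def traceRight (I K : Type) [Fintype K] : Op (I × K) →ₗ[ℂ] Op I where
  toFun ρ := Matrix.of fun i i' => ∑ k, ρ (i, k) (i', k)
  map_add' ρ σ := by
    ext i i'
    simp [Finset.sum_add_distrib]
  map_smul' c ρ := by
    ext i i'
    simp [Finset.mul_sum]

/-- The map `ρ ↦ ρ ⊗ σ`, which adjoins a system in the state `σ`. -/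
def append (I : Type) {K : Type} (σ : Op K) : Op I →ₗ[ℂ] Op (I × K) where
  toFun ρ := ρ ⊗ₖ σ
  map_add' ρ ρ' := Matrix.add_kronecker ρ ρ' σ
  map_smul' c ρ := Matrix.smul_kronecker c ρ σ

/-- Complete positivity. -/
def IsCP {I J : Type} [Fintype I] [Fintype J] (Φ : Op I →ₗ[ℂ] Op J) : Prop :=
  ∀ (K : Type) [Fintype K] (ρ : Op (I × K)), ρ.PosSemidef → (tensorId Φ K ρ).PosSemidef

/-- Completely positive, trace-preserving maps. -/
def IsChannel {I J : Type} [Fintype I] [Fintype J] (Φ : Op I →ₗ[ℂ] Op J) : Prop :=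
  IsCP Φ ∧ ∀ ρ : Op I, (Φ ρ).trace = ρ.trace

/-- Completely positive, trace non-increasing maps. -/
def IsSubchannel {I J : Type} [Fintype I] [Fintype J] (Φ : Op I →ₗ[ℂ] Op J) : Prop :=
  IsCP Φ ∧ ∀ ρ : Op I, ρ.PosSemidef → (Φ ρ).trace.re ≤ ρ.trace.re

/-- The diamond distance `½‖Φ - Ψ‖_⋄`: the supremum, over all finite-dimensional reference systems
`R` and all normalized states of `IR`, of the trace distance of the outputs. -/
def diamondDist {I J : Type} [Fintype I] [Fintype J] [DecidableEq J]
    (Φ Ψ : Op I →ₗ[ℂ] Op J) : EReal :=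
  ⨆ (R : Type) (_ : Fintype R) (_ : DecidableEq R) (ρ : Op (I × R)) (_ : IsState ρ),
    (traceDist (tensorId Φ R ρ) (tensorId Ψ R ρ) : EReal)

/-! ### Closure properties -/

section Closure

variable {I J K L : Type} [Fintype I] [Fintype J] [Fintype K] [Fintype L]

theorem IsCP.comp {Φ : Op J →ₗ[ℂ] Op K} {Ψ : Op I →ₗ[ℂ] Op J} (h : IsCP Φ) (h' : IsCP Ψ) :
    IsCP (Φ ∘ₗ Ψ) := by
  intro X _ ρ hρ
  exact h X _ (h' X ρ hρ)

theorem IsChannel.comp {Φ : Op J →ₗ[ℂ] Op K} {Ψ : Op I →ₗ[ℂ] Op J} (h : IsChannel Φ)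
    (h' : IsChannel Ψ) : IsChannel (Φ ∘ₗ Ψ) :=
  ⟨h.1.comp h'.1, fun ρ => by rw [LinearMap.comp_apply, h.2, h'.2]⟩

theorem IsCP.add {Φ Ψ : Op I →ₗ[ℂ] Op J} (h : IsCP Φ) (h' : IsCP Ψ) : IsCP (Φ + Ψ) := by
  intro X _ ρ hρ
  exact (h X ρ hρ).add (h' X ρ hρ)

theorem IsCP.map_posSemidef {Φ : Op I →ₗ[ℂ] Op J} (h : IsCP Φ) {ρ : Op I} (hρ : ρ.PosSemidef) :
    (Φ ρ).PosSemidef :=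
  (h Unit (ρ.submatrix Prod.fst Prod.fst) (hρ.submatrix _)).submatrix (fun j => (j, ()))

theorem IsChannel.map_state {Φ : Op I →ₗ[ℂ] Op J} (h : IsChannel Φ) {ρ : Op I} (hρ : IsState ρ) :
    IsState (Φ ρ) :=
  ⟨h.1.map_posSemidef hρ.1, by rw [h.2, hρ.2]⟩

/-- A map that conjugates by an injection of basis labels is completely positive. -/
theorem isCP_of_submatrix (f : J → I) (Φ : Op I →ₗ[ℂ] Op J)
    (h : ∀ ρ, Φ ρ = ρ.submatrix f f) : IsCP Φ := by
  intro X _ ρ hρ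
  have : tensorId Φ X ρ = ρ.submatrix (Prod.map f id) (Prod.map f id) := by
    ext p q
    exact congrFun (congrFun (h _) p.1) q.1
  rw [this]
  exact hρ.submatrix _

theorem isChannel_assoc : IsChannel (assoc I J K).toLinearMap := by
  refine ⟨isCP_of_submatrix (Equiv.prodAssoc I J K).symm _ fun ρ => rfl, fun ρ => ?_⟩
  exact Equiv.sum_comp (Equiv.prodAssoc I J K).symm fun x => ρ x x

theorem isChannel_assoc_symm : IsChannel (assoc I J K).symm.toLinearMap := by
  refine ⟨isCP_of_submatrix (Equiv.prodAssoc I J K) _ fun ρ => rfl, fun ρ => ?_⟩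
  exact Equiv.sum_comp (Equiv.prodAssoc I J K) fun x => ρ x x

theorem isChannel_idTensor {Φ : Op I →ₗ[ℂ] Op J} (h : IsChannel Φ) :
    IsChannel (idTensor K Φ) := by
  constructor
  · intro X _ ρ hρ
    have h1 := h.1 (K × X) (ρ.submatrix (fun p => ((p.2.1, p.1), p.2.2))
      (fun p => ((p.2.1, p.1), p.2.2))) (hρ.submatrix _)
    exact h1.submatrix (fun p : (K × J) × X => (p.1.2, (p.1.1, p.2)))
  · intro ρ
    have h1 := fun k => h.2 (Matrix.of fun i i' => ρ (k, i) (k, i'))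
    simp only [Matrix.trace, Matrix.diag_apply, Fintype.sum_prod_type] at h1 ⊢
    exact Finset.sum_congr rfl fun k _ => h1 k

theorem isChannel_traceRight : IsChannel (traceRight I K) := by
  constructor
  · intro X _ ρ hρ
    have : tensorId (traceRight I K) X ρ =
        ∑ k, ρ.submatrix (fun p : I × X => ((p.1, k), p.2)) (fun p => ((p.1, k), p.2)) := by
      ext p q
      simp [tensorId, traceRight, Matrix.sum_apply]
    rw [this]
    exact Matrix.posSemidef_sum _ fun k _ => hρ.submatrix _
  · intro ρ
    simp [Matrix.trace, traceRight, Fintype.sum_prod_type]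

theorem isCP_append {σ : Op K} (hσ : σ.PosSemidef) : IsCP (append I σ) := by
  intro X _ ρ hρ
  exact (hρ.kronecker hσ).submatrix (fun p : (I × K) × X => ((p.1.1, p.2), p.1.2))

theorem isChannel_append {σ : Op K} (hσ : IsState σ) : IsChannel (append I σ) := by
  refine ⟨isCP_append hσ.1, fun ρ => ?_⟩
  change (ρ ⊗ₖ σ).trace = _
  rw [Matrix.trace_kronecker, hσ.2, mul_one]

theorem isState_single [DecidableEq I] (i : I) : IsState (Matrix.single i i (1 : ℂ)) := by
  refine ⟨?_, by simp⟩
  have : Matrix.single i i (1 : ℂ) = Matrix.diagonal (Pi.single i 1) := by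
    rw [Matrix.diagonal_single]
  rw [this]
  refine Matrix.PosSemidef.diagonal fun j => ?_
  by_cases h : j = i
  · subst h; simp
  · simp [h]

end Closure

/-! ### Two-party interactions -/

/-- The half of a two-party protocol seen by the party at the other end of the channel `C`: a
quantum comb. It receives the input `A`, then sends `N` messages on `C` and waits for a reply after
each of them, and finally outputs `A`. -/
structure Comb (A C : Type) [Fintype A] [Fintype C] (N : ℕ) where
  /-- The internal memory. -/
  Mem : Type
  [fintypeMem : Fintype Mem]
  /-- Operation up to the first message. -/
  start : Op A →ₗ[ℂ] Op (Mem × C)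
  start_channel : IsChannel start
  /-- Operation performed upon the reply number `i`. -/
  step : Fin N → Op (Mem × C) →ₗ[ℂ] Op (Mem × C)
  step_channel : ∀ i, IsChannel (step i)
  /-- Production of the final output. -/
  finish : Op (Mem × C) →ₗ[ℂ] Op A
  finish_channel : IsChannel finish

attribute [instance] Comb.fintypeMem

namespace Comb

variable {A C : Type} [Fintype A] [Fintype C] {N : ℕ}

/-- The joint state of the comb, the channel and the register `B` of the other party, after `k`
replies, when that party applies `F i : L(CB) → L(CB)` as its reply number `i`. -/
def stateAfter (S : Comb A C N) {B : Type} (F : Fin N → Op (C × B) →ₗ[ℂ] Op (C × B))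
    (k : Fin (N + 1)) : Op (A × B) →ₗ[ℂ] Op ((S.Mem × C) × B) :=
  Fin.induction (motive := fun _ => Op (A × B) →ₗ[ℂ] Op ((S.Mem × C) × B))
    (tensorId S.start B)
    (fun i T => tensorId (S.step i) B ∘ₗ (assoc S.Mem C B).symm.toLinearMap ∘ₗ
      idTensor S.Mem (F i) ∘ₗ (assoc S.Mem C B).toLinearMap ∘ₗ T) k

/-- The map `L(AB) → L(AB)` of a whole interaction. -/
def run (S : Comb A C N) {B : Type} (F : Fin N → Op (C × B) →ₗ[ℂ] Op (C × B)) :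
    Op (A × B) →ₗ[ℂ] Op (A × B) :=
  tensorId S.finish B ∘ₗ S.stateAfter F (Fin.last N)

/-- The distinguishing advantage between two combs: the supremum of the trace distance of the final
states, over all registers `R` of the distinguisher, all initial states of `AR` and all its maps
`D i : L(CR) → L(CR)`. -/
def advantage [DecidableEq A] (S T : Comb A C N) : EReal :=
  ⨆ (R : Type) (_ : Fintype R) (_ : DecidableEq R)
    (D : Fin N → Op (C × R) →ₗ[ℂ] Op (C × R)) (_ : ∀ i, IsChannel (D i))
    (ρ : Op (A × R)) (_ : IsState ρ),
    (traceDist (S.run D ρ) (T.run D ρ) : EReal)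

end Comb

/-! ### Delegated quantum computation -/

/-- What is delegated: the computation `U` on Alice's register, the error flag, which is a unit
vector orthogonal to all outputs of `U`, and the (fixed, classical) permitted leak. -/
structure Task (A L : Type) [Fintype A] where
  U : Op A →ₗ[ℂ] Op A
  U_channel : IsChannel U
  err : A → ℂ
  err_norm : star err ⬝ᵥ err = 1
  U_orthogonal_err : ∀ ρ : Op A, IsState ρ → Matrix.mulVec (U ρ) err = 0
  leak : L

/-- Alice's part of a DQC protocol in which the channel is initially in the basis state `zero`.
Alice applies `E 0` to `AC`, sends `C` to Bob, applies `E 1` when `C` returns, and so on; there are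
`N` messages to Bob and `N` replies. Her output is the final content of `A`. -/
structure Protocol (A C : Type) [Fintype A] [Fintype C] (N : ℕ) where
  zero : C
  E : Fin (N + 1) → Op (A × C) →ₗ[ℂ] Op (A × C)
  E_channel : ∀ i, IsChannel (E i)

/-- The real resource: Alice's protocol plugged into the channel. -/
def Protocol.comb {A C : Type} [Fintype A] [DecidableEq A] [Fintype C] [DecidableEq C] {N : ℕ}
    (π : Protocol A C N) : Comb A C N where
  Mem := A
  start := π.E 0 ∘ₗ append A (Matrix.single π.zero π.zero 1)
  start_channel := (π.E_channel 0).comp (isChannel_append (isState_single _))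
  step i := π.E i.succ
  step_channel i := π.E_channel i.succ
  finish := traceRight A C
  finish_channel := isChannel_traceRight

/-- The map `E^err`, which discards `A` and outputs the error flag. -/
def Task.errMap {A L : Type} [Fintype A] (T : Task A L) : Op A →ₗ[ℂ] Op A :=
  (Matrix.traceLinearMap A ℂ ℂ).smulRight (Matrix.vecMulVec T.err (star T.err))

/-- Stand-alone `ε`-blind verifiability. -/
def BlindVerifiable {A C L : Type} [Fintype A] [DecidableEq A] [Fintype C] [DecidableEq C] {N : ℕ}
    (T : Task A L) (π : Protocol A C N) (ε : ℝ) : Prop :=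
  ∀ (B : Type) [Fintype B] [DecidableEq B] (F : Fin N → Op (C × B) →ₗ[ℂ] Op (C × B)),
    (∀ i, IsChannel (F i)) →
    ∃ Fok Ferr : Op B →ₗ[ℂ] Op B, IsSubchannel Fok ∧ IsSubchannel Ferr ∧
      diamondDist (π.comb.run F) (tensorMap T.U Fok + tensorMap T.errMap Ferr) ≤ (ε : EReal)

/-- The restriction of an operator on `I ⊗ Bool` to the outcome `b` of a measurement of the bit. -/
def block (I : Type) (b : Bool) : Op (I × Bool) →ₗ[ℂ] Op I where
  toFun ρ := Matrix.of fun i i' => ρ (i, b) (i', b)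
  map_add' _ _ := rfl
  map_smul' _ _ := rfl

/-- The output of the ideal resource, from its input `A` and the two bits `b` and `c`: the error
flag if `b = c = 1`, and the correct result otherwise. -/
def Task.output {A L : Type} [Fintype A] (T : Task A L) : Op ((A × Bool) × Bool) →ₗ[ℂ] Op A :=
  ∑ b : Bool, ∑ c : Bool,
    (if b && c then T.errMap else T.U) ∘ₗ block A b ∘ₗ block (A × Bool) c

theorem isChannel_errMap {A L : Type} [Fintype A] (T : Task A L) : IsChannel T.errMap := by
  constructor
  · intro X _ ρ hρ
    have h : (Matrix.of fun x x' : X => ∑ a, ρ (a, x) (a, x')).PosSemidef := by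
      have h0 : (Matrix.of fun x x' : X => ∑ a, ρ (a, x) (a, x')) =
          ∑ a, ρ.submatrix (fun x : X => (a, x)) (fun x => (a, x)) := by
        ext x x'
        simp [Matrix.sum_apply]
      rw [h0]
      exact Matrix.posSemidef_sum _ fun a _ => hρ.submatrix _
    have h1 := (Matrix.posSemidef_vecMulVec_self_star T.err).kronecker h
    have h2 : tensorId T.errMap X ρ = Matrix.vecMulVec T.err (star T.err) ⊗ₖ
        (Matrix.of fun x x' : X => ∑ a, ρ (a, x) (a, x')) := by
      ext p q
      simp [tensorId, Task.errMap, Matrix.trace, Matrix.kroneckerMap_apply, mul_comm]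
    rw [h2]
    exact h1
  · intro ρ
    have h := T.err_norm
    rw [dotProduct_comm] at h
    simp [Task.errMap, Matrix.trace_vecMulVec, h]

theorem isChannel_output {A L : Type} [Fintype A] (T : Task A L) : IsChannel T.output := by
  have hblock : ∀ (I : Type) [Fintype I] (b : Bool), IsCP (block I b) := fun I _ b =>
    isCP_of_submatrix (fun i => (i, b)) _ fun ρ => rfl
  have hch : ∀ b c : Bool, IsChannel (if b && c then T.errMap else T.U) := fun b c => by
    split_ifs
    exacts [isChannel_errMap T, T.U_channel]
  constructor
  · simp only [Task.output, Fintype.sum_bool]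
    have h := fun b c => (hch b c).1.comp ((hblock A b).comp (hblock (A × Bool) c))
    exact ((h true true).add (h true false)).add ((h false true).add (h false false))
  · intro ρ
    simp only [Task.output, LinearMap.sum_apply, Matrix.trace_sum, LinearMap.comp_apply, (hch _ _).2]
    simp only [Matrix.trace, Matrix.diag_apply, Fintype.sum_prod_type, Fintype.sum_bool,
      Finset.sum_add_distrib]
    rfl

/-- A simulator. It first prepares its memory and the bit `b` for the ideal resource, which reads
it. If `b = 1`, it receives the leak. Then it talks with the outside on the channel `C`, and in the
end it turns its memory into the bit `c` for the ideal resource, which reads it. -/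
structure Simulator (C L : Type) [Fintype C] [Fintype L] (N : ℕ) where
  Mem : Type
  [fintypeMem : Fintype Mem]
  init : Op (Mem × Bool)
  init_state : IsState init
  receiveLeak : Op (Mem × L) →ₗ[ℂ] Op Mem
  receiveLeak_channel : IsChannel receiveLeak
  /-- Production of the first message. -/
  first : Op Mem →ₗ[ℂ] Op (Mem × C)
  first_channel : IsChannel first
  step : Fin N → Op (Mem × C) →ₗ[ℂ] Op (Mem × C)
  step_channel : ∀ i, IsChannel (step i)
  final : Op (Mem × C) →ₗ[ℂ] Op Bool
  final_channel : IsChannel final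

attribute [instance] Simulator.fintypeMem

section Ideal

variable {A C L : Type} [Fintype A] [Fintype C] [Fintype L] [DecidableEq L] {N : ℕ}

/-- The state of the bit `b`, now stored in the ideal resource, and of the simulator's memory, after
the resource has read `b` and, if `b = 1`, the simulator has received the leak. -/
def afterLeak (T : Task A L) (σ : Simulator C L N) : Op (Bool × σ.Mem) :=
  Matrix.single false false 1 ⊗ₖ block σ.Mem false σ.init +
    Matrix.single true true 1 ⊗ₖ
      σ.receiveLeak (append σ.Mem (Matrix.single T.leak T.leak 1) (block σ.Mem true σ.init))

theorem isState_afterLeak (T : Task A L) (σ : Simulator C L N) : IsState (afterLeak T σ) := by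
  have hb : ∀ b, (block σ.Mem b σ.init).PosSemidef := fun b =>
    σ.init_state.1.submatrix fun i => (i, b)
  have hr := σ.receiveLeak_channel.comp (isChannel_append (I := σ.Mem) (isState_single T.leak))
  constructor
  · exact ((isState_single false).1.kronecker (hb false)).add
      ((isState_single true).1.kronecker (hr.1.map_posSemidef (hb true)))
  · have h2 := hr.2 (block σ.Mem true σ.init)
    rw [LinearMap.comp_apply] at h2
    have h3 := σ.init_state.2
    rw [afterLeak, Matrix.trace_add, Matrix.trace_kronecker, Matrix.trace_kronecker, h2,
      (isState_single false).2, (isState_single true).2, one_mul, one_mul, ← h3]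
    simp only [Matrix.trace, Matrix.diag_apply, Fintype.sum_prod_type, Fintype.sum_bool,
      Finset.sum_add_distrib]
    exact add_comm _ _

/-- The ideal resource that provides blindness and verifiability, with the simulator plugged into
its Bob-interface. The resource stores Alice's input and the bit `b`. -/
def Simulator.comb [DecidableEq A] (σ : Simulator C L N) (T : Task A L) : Comb A C N where
  Mem := (A × Bool) × σ.Mem
  start := (assoc (A × Bool) σ.Mem C).symm.toLinearMap ∘ₗ idTensor (A × Bool) σ.first ∘ₗ
    (assoc A Bool σ.Mem).symm.toLinearMap ∘ₗ append A (afterLeak T σ)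
  start_channel := isChannel_assoc_symm.comp ((isChannel_idTensor σ.first_channel).comp
    (isChannel_assoc_symm.comp (isChannel_append (isState_afterLeak T σ))))
  step i := (assoc (A × Bool) σ.Mem C).symm.toLinearMap ∘ₗ idTensor (A × Bool) (σ.step i) ∘ₗ
    (assoc (A × Bool) σ.Mem C).toLinearMap
  step_channel i := isChannel_assoc_symm.comp
    ((isChannel_idTensor (σ.step_channel i)).comp isChannel_assoc)
  finish := T.output ∘ₗ idTensor (A × Bool) σ.final ∘ₗ (assoc (A × Bool) σ.Mem C).toLinearMap
  finish_channel := (isChannel_output T).comp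
    ((isChannel_idTensor σ.final_channel).comp isChannel_assoc)

/-- Composable `ε`-security: some simulator makes the real resource `ε`-indistinguishable from the
ideal resource. -/
def Secure [DecidableEq A] [DecidableEq C] (T : Task A L) (π : Protocol A C N) (ε : ℝ) : Prop :=
  ∃ σ : Simulator C L N, Comb.advantage π.comb (σ.comb T) ≤ (ε : EReal)

end Ideal

end DQC

end

namespace DQC

/-! ### The trace norm of Hermitian operators -/

section TraceNorm

variable {I J : Type} [Fintype I] [DecidableEq I] [Fintype J] [DecidableEq J]

/-! Both directions rest on the form of the ideal system. Alice's input and the bit `b` wait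
untouched in the resource while the simulator interacts, so with any simulator the map on `AB` is
exactly a sum of four products, one for each value of `(b, c)` (`Simulator.run_comb`). The branch `b
= c = 1` carries `E^err`, the other three carry `U`. This is already the form demanded by blind
verifiability, and the reference system of the diamond distance can be held by the distinguisher
(`Comb.tensorId_run`). So security gives blind verifiability with the same `ε`.

For the other direction the simulator runs Alice's protocol on a fixed dummy input and measures
whether the output is the error flag. Fix the distinguisher's maps `D`; blind verifiability yields
`Fok` and `Ferr` independent of the input. The real run is `ε`-close to `U ⊗ Fok + E^err ⊗ Ferr`.
The simulated run is the same attack on the dummy input, with the true input as reference, followed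
by a fixed channel (`Protocol.run_simulator`). Replacing the attack by its product form costs
another `ε`. Since the flag is orthogonal to the outputs of `U`, the measurement then reads it
without error, and what remains is exactly `U ⊗ Fok + E^err ⊗ Ferr` on the true input
(`Task.correct_product`). The triangle inequality gives `2ε`. -/

theorem traceNorm_eq_trace_abs (M : Op I) : traceNorm M = (CFC.abs M).trace.re := rfl

theorem re_trace_mul_nonneg {P Q : Op I} (hP : P.PosSemidef) (hQ : Q.PosSemidef) :
    0 ≤ (P * Q).trace.re := by
  obtain ⟨B, rfl⟩ := CStarAlgebra.nonneg_iff_eq_star_mul_self.mp hQ.nonneg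
  rw [← mul_assoc, Matrix.trace_mul_comm, ← mul_assoc]
  exact (Complex.nonneg_iff.mp (hP.mul_mul_conjTranspose_same B).trace_nonneg).1

/-- With `S` the sign of `M = P - Q`, the trace norm is `tr(SP) - tr(SQ)`, and `-1 ≤ S ≤ 1` bounds
the two terms separately. -/
theorem traceNorm_sub_le {P Q : Op I} (hP : P.PosSemidef) (hQ : Q.PosSemidef) :
    traceNorm (P - Q) ≤ P.trace.re + Q.trace.re := by
  set M := P - Q with hM
  have hMs : IsSelfAdjoint M := (hP.isHermitian.sub hQ.isHermitian).isSelfAdjoint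
  -- The sign function is discontinuous, but on a finite spectrum every function is continuous.
  have hcont : ∀ f : ℝ → ℝ, ContinuousOn f (spectrum ℝ M) := fun f =>
    (Matrix.finite_real_spectrum (A := M)).continuousOn f
  set f : ℝ → ℝ := fun x => if 0 ≤ x then 1 else -1 with hf
  set S : Op I := cfc f M
  have habs : CFC.abs M = S * M := by
    rw [CFC.abs_eq_cfc_norm M hMs]
    conv_rhs => rw [← cfc_id ℝ M, ← cfc_mul _ _ M (hcont _) (hcont _)]
    refine congrArg (fun g => cfc g M) (funext fun x => ?_)
    by_cases h : 0 ≤ x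
    · simp [hf, h, abs_of_nonneg h]
    · simp [hf, h, abs_of_neg (not_le.mp h)]
  have hS1 : (1 - S).PosSemidef := by
    refine Matrix.le_iff.mp (cfc_le_one f M fun x _ => ?_)
    simp only [hf]; split_ifs <;> norm_num
  have hS2 : (1 + S).PosSemidef := by
    have h : cfc (fun x => -f x) M ≤ 1 := cfc_le_one _ M fun x _ => by
      simp only [hf]; split_ifs <;> norm_num
    rw [cfc_neg] at h
    simpa using Matrix.le_iff.mp h
  have h1 := re_trace_mul_nonneg hS1 hP
  have h2 := re_trace_mul_nonneg hS2 hQ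
  rw [traceNorm_eq_trace_abs, habs, hM]
  simp only [sub_mul, add_mul, mul_sub, one_mul, Matrix.trace_sub, Matrix.trace_add, Complex.sub_re,
    Complex.add_re] at h1 h2 ⊢
  linarith

/-- The Jordan decomposition attains equality in `traceNorm_sub_le`. The two together yield the
triangle inequality and monotonicity for all Hermitian operators; normalization is not available
later, as `Fok` and `Ferr` need not sum to a trace-preserving map. -/
theorem exists_posSemidef_sub {M : Op I} (hM : M.IsHermitian) :
    ∃ P Q : Op I, P.PosSemidef ∧ Q.PosSemidef ∧ M = P - Q ∧
      traceNorm M = P.trace.re + Q.trace.re := by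
  have hMs : IsSelfAdjoint M := hM.isSelfAdjoint
  refine ⟨M⁺, M⁻, Matrix.nonneg_iff_posSemidef.mp (CFC.posPart_nonneg M),
    Matrix.nonneg_iff_posSemidef.mp (CFC.negPart_nonneg M),
    (CFC.posPart_sub_negPart M).symm, ?_⟩
  rw [traceNorm_eq_trace_abs, ← Complex.add_re, ← Matrix.trace_add, CFC.posPart_add_negPart M]

/-- The triangle inequality for the trace distance. -/
theorem traceDist_triangle {ρ σ τ : Op I} (hρ : ρ.IsHermitian) (hσ : σ.IsHermitian)
    (hτ : τ.IsHermitian) : traceDist ρ τ ≤ traceDist ρ σ + traceDist σ τ := by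
  obtain ⟨P, Q, hP, hQ, h, hn⟩ := exists_posSemidef_sub (hρ.sub hσ)
  obtain ⟨P', Q', hP', hQ', h', hn'⟩ := exists_posSemidef_sub (hσ.sub hτ)
  have h1 := traceNorm_sub_le (hP.add hP') (hQ.add hQ')
  have h2 : ρ - τ = (P + P') - (Q + Q') := by
    rw [← sub_add_sub_cancel ρ σ τ, h, h']; abel
  rw [traceDist, traceDist, traceDist, h2, hn, hn']
  simp only [Matrix.trace_add, Complex.add_re] at h1
  linarith

theorem traceDist_comm {ρ σ : Op I} : traceDist ρ σ = traceDist σ ρ := by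
  rw [traceDist, traceDist, traceNorm_eq_trace_abs, traceNorm_eq_trace_abs, ← neg_sub, CFC.abs_neg]

/-- Positive trace-preserving maps do not increase the trace distance. -/
theorem traceDist_map_le {Φ : Op I →ₗ[ℂ] Op J} (hpos : ∀ ρ : Op I, ρ.PosSemidef → (Φ ρ).PosSemidef)
    (htr : ∀ ρ, (Φ ρ).trace = ρ.trace) {ρ σ : Op I} (hρ : ρ.IsHermitian) (hσ : σ.IsHermitian) :
    traceDist (Φ ρ) (Φ σ) ≤ traceDist ρ σ := by
  obtain ⟨P, Q, hP, hQ, h, hn⟩ := exists_posSemidef_sub (hρ.sub hσ)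
  rw [traceDist, traceDist, ← map_sub, h, map_sub, ← h, hn, ← htr P, ← htr Q]
  gcongr
  exact traceNorm_sub_le (hpos P hP) (hpos Q hQ)

theorem IsChannel.traceDist_le {Φ : Op I →ₗ[ℂ] Op J} (h : IsChannel Φ) {ρ σ : Op I}
    (hρ : ρ.IsHermitian) (hσ : σ.IsHermitian) : traceDist (Φ ρ) (Φ σ) ≤ traceDist ρ σ :=
  traceDist_map_le (fun _ => h.1.map_posSemidef) h.2 hρ hσ

end TraceNorm

/-! ### Interactions with spectator and reference registers -/

section Interact

variable {A C M : Type} {N : ℕ}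

theorem IsCP.tensorId {I J : Type} [Fintype I] [Fintype J] {Φ : Op I →ₗ[ℂ] Op J}
    (h : IsCP Φ) (K : Type) [Fintype K] : IsCP (tensorId Φ K) := by
  intro X _ ρ hρ
  exact (h (K × X) (ρ.submatrix (Equiv.prodAssoc I K X).symm (Equiv.prodAssoc I K X).symm)
    (hρ.submatrix _)).submatrix (Equiv.prodAssoc J K X)

theorem IsCP.idTensor {I J : Type} [Fintype I] [Fintype J] {Φ : Op I →ₗ[ℂ] Op J}
    (h : IsCP Φ) (K : Type) [Fintype K] : IsCP (idTensor K Φ) := by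
  intro X _ ρ hρ
  exact (h (K × X) (ρ.submatrix (fun p => ((p.2.1, p.1), p.2.2))
    (fun p => ((p.2.1, p.1), p.2.2))) (hρ.submatrix _)).submatrix
      (fun p : (K × J) × X => (p.1.2, (p.1.1, p.2)))

theorem isChannel_tensorId {I J : Type} [Fintype I] [Fintype J] {Φ : Op I →ₗ[ℂ] Op J}
    (h : IsChannel Φ) (K : Type) [Fintype K] : IsChannel (tensorId Φ K) := by
  refine ⟨h.1.tensorId K, fun ρ => ?_⟩
  have h1 := fun k => h.2 (Matrix.of fun i i' => ρ (i, k) (i', k))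
  simp only [Matrix.trace, Matrix.diag_apply, Fintype.sum_prod_type_right] at h1 ⊢
  exact Finset.sum_congr rfl fun k _ => h1 k

/-- The interaction of a sequence of maps on `MC` with a sequence of maps on `CB`. -/
def interact (step : Fin N → Op (M × C) →ₗ[ℂ] Op (M × C)) {B : Type}
    (F : Fin N → Op (C × B) →ₗ[ℂ] Op (C × B)) (k : Fin (N + 1)) :
    Op ((M × C) × B) →ₗ[ℂ] Op ((M × C) × B) :=
  Fin.induction (motive := fun _ => Op ((M × C) × B) →ₗ[ℂ] Op ((M × C) × B)) LinearMap.id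
    (fun i T => tensorId (step i) B ∘ₗ (assoc M C B).symm.toLinearMap ∘ₗ
      idTensor M (F i) ∘ₗ (assoc M C B).toLinearMap ∘ₗ T) k

theorem interact_succ (step : Fin N → Op (M × C) →ₗ[ℂ] Op (M × C)) {B : Type}
    (F : Fin N → Op (C × B) →ₗ[ℂ] Op (C × B)) (i : Fin N) :
    interact step F i.succ = tensorId (step i) B ∘ₗ (assoc M C B).symm.toLinearMap ∘ₗ
      idTensor M (F i) ∘ₗ (assoc M C B).toLinearMap ∘ₗ interact step F i.castSucc := rfl

theorem isChannel_id {I : Type} [Fintype I] : IsChannel (LinearMap.id : Op I →ₗ[ℂ] Op I) :=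
  ⟨fun _ _ _ h => h, fun _ => rfl⟩

/-- Maps that leave the register `Z` alone, acting on `(ZM)C`. -/
def withSpectator (Z : Type) (step : Op (M × C) →ₗ[ℂ] Op (M × C)) :
    Op ((Z × M) × C) →ₗ[ℂ] Op ((Z × M) × C) :=
  (assoc Z M C).symm.toLinearMap ∘ₗ idTensor Z step ∘ₗ (assoc Z M C).toLinearMap

/-- A spectator register held by the first party does not take part in the interaction. -/
theorem interact_withSpectator (step : Fin N → Op (M × C) →ₗ[ℂ] Op (M × C)) {B : Type}
    (F : Fin N → Op (C × B) →ₗ[ℂ] Op (C × B)) (Z : Type) (k : Fin (N + 1))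
    (ρ : Op (((Z × M) × C) × B)) (z z' : Z) :
    (Matrix.of fun p q : (M × C) × B => interact (fun i => withSpectator Z (step i)) F k ρ
      (((z, p.1.1), p.1.2), p.2) (((z', q.1.1), q.1.2), q.2)) =
    interact step F k (Matrix.of fun p q => ρ (((z, p.1.1), p.1.2), p.2)
      (((z', q.1.1), q.1.2), q.2)) := by
  induction k using Fin.induction with
  | zero => rfl
  | succ i ih =>
    rw [interact_succ, interact_succ]
    simp only [LinearMap.comp_apply]
    -- Every map in a round acts within the block `(z, z')`, so the remaining equality is a
    -- definitional matching of indices.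
    rw [← ih]
    rfl

/-- `Φ ⊗ id_R` for a map `Φ` on `CB`. -/
def withReference {B : Type} (R : Type) (F : Op (C × B) →ₗ[ℂ] Op (C × B)) :
    Op (C × (B × R)) →ₗ[ℂ] Op (C × (B × R)) :=
  (assoc C B R).toLinearMap ∘ₗ tensorId F R ∘ₗ (assoc C B R).symm.toLinearMap

/-- The counterpart of `interact_withSpectator` for a register of the other party: each block `(r,
r')` evolves on its own. -/
theorem interact_withReference (step : Fin N → Op (M × C) →ₗ[ℂ] Op (M × C)) {B : Type}
    (F : Fin N → Op (C × B) →ₗ[ℂ] Op (C × B)) (R : Type) (k : Fin (N + 1))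
    (ρ : Op ((M × C) × (B × R))) (r r' : R) :
    (Matrix.of fun p q : (M × C) × B => interact step (fun i => withReference R (F i)) k ρ
      (p.1, (p.2, r)) (q.1, (q.2, r'))) =
    interact step F k (Matrix.of fun p q => ρ (p.1, (p.2, r)) (q.1, (q.2, r'))) := by
  induction k using Fin.induction with
  | zero => rfl
  | succ i ih =>
    rw [interact_succ, interact_succ]
    simp only [LinearMap.comp_apply]
    rw [← ih]
    rfl

variable [Fintype A] [Fintype C]

theorem isChannel_interact [Fintype M] {step : Fin N → Op (M × C) →ₗ[ℂ] Op (M × C)}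
    (hstep : ∀ i, IsChannel (step i)) {B : Type} [Fintype B]
    {F : Fin N → Op (C × B) →ₗ[ℂ] Op (C × B)} (hF : ∀ i, IsChannel (F i)) (k : Fin (N + 1)) :
    IsChannel (interact step F k) := by
  induction k using Fin.induction with
  | zero => exact isChannel_id
  | succ i ih =>
    exact (isChannel_tensorId (hstep i) B).comp (isChannel_assoc_symm.comp
      ((isChannel_idTensor (hF i)).comp (isChannel_assoc.comp ih)))

theorem Comb.stateAfter_eq (S : Comb A C N) {B : Type} (F : Fin N → Op (C × B) →ₗ[ℂ] Op (C × B))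
    (k : Fin (N + 1)) : S.stateAfter F k = interact S.step F k ∘ₗ tensorId S.start B := by
  induction k using Fin.induction with
  | zero => rfl
  | succ i ih =>
    rw [interact_succ]
    simp only [LinearMap.comp_assoc]
    rw [← ih]
    rfl

theorem Comb.run_eq (S : Comb A C N) {B : Type} (F : Fin N → Op (C × B) →ₗ[ℂ] Op (C × B)) :
    S.run F = tensorId S.finish B ∘ₗ interact S.step F (Fin.last N) ∘ₗ tensorId S.start B := by
  rw [Comb.run, Comb.stateAfter_eq]

theorem Comb.isChannel_run (S : Comb A C N) {B : Type} [Fintype B]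
    {F : Fin N → Op (C × B) →ₗ[ℂ] Op (C × B)} (hF : ∀ i, IsChannel (F i)) :
    IsChannel (S.run F) := by
  rw [Comb.run_eq]
  exact (isChannel_tensorId S.finish_channel B).comp
    ((isChannel_interact S.step_channel hF _).comp (isChannel_tensorId S.start_channel B))

theorem isChannel_withReference {B : Type} [Fintype B] (R : Type) [Fintype R]
    {F : Op (C × B) →ₗ[ℂ] Op (C × B)} (hF : IsChannel F) : IsChannel (withReference R F) :=
  isChannel_assoc.comp ((isChannel_tensorId hF R).comp isChannel_assoc_symm)

/-- Running a comb next to a reference system `R` is the same as giving `R` to the other party. -/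
theorem Comb.tensorId_run (S : Comb A C N) {B : Type} (F : Fin N → Op (C × B) →ₗ[ℂ] Op (C × B))
    (R : Type) (ρ : Op ((A × B) × R)) :
    tensorId (S.run F) R ρ =
      (assoc A B R).symm (S.run (fun i => withReference R (F i)) (assoc A B R ρ)) := by
  ext ⟨⟨a, b⟩, r⟩ ⟨⟨a', b'⟩, r'⟩
  have h := interact_withReference S.step F R (Fin.last N)
    (tensorId S.start (B × R) (assoc A B R ρ)) r r'
  simp only [Comb.run_eq, LinearMap.comp_apply]
  have h2 := congrArg (fun X => tensorId S.finish B X (a, b) (a', b')) h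
  exact h2.symm

end Interact

/-! ### The ideal system as a sum of products, and security implies blind verifiability -/

/-- The map `ρ ↦ τ ⊗ ρ`. -/
def prepend (I : Type) {K : Type} (τ : Op K) : Op I →ₗ[ℂ] Op (K × I) where
  toFun ρ := Matrix.of fun p q => ρ p.2 q.2 * τ p.1 q.1
  map_add' ρ ρ' := by
    ext p q
    simp [add_mul]
  map_smul' c ρ := by
    ext p q
    simp [mul_assoc]

theorem isCP_prepend {I K : Type} [Fintype I] [Fintype K] {τ : Op K} (hτ : τ.PosSemidef) :
    IsCP (prepend I τ) := by
  intro X _ ρ hρ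
  exact (hρ.kronecker hτ).submatrix (fun p : (K × I) × X => ((p.1.2, p.2), p.1.1))

theorem trace_prepend {I K : Type} [Fintype I] [Fintype K] (τ : Op K) (ρ : Op I) :
    (prepend I τ ρ).trace = ρ.trace * τ.trace := by
  simp [Matrix.trace, prepend, Fintype.sum_prod_type_right, Finset.sum_mul_sum]

/-- The restriction of an operator on `Bool ⊗ I` to the outcome `c` of a measurement of the bit. -/
def blockLeft (I : Type) (c : Bool) : Op (Bool × I) →ₗ[ℂ] Op I where
  toFun ρ := Matrix.of fun i i' => ρ (c, i) (c, i')
  map_add' _ _ := rfl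
  map_smul' _ _ := rfl

theorem isCP_blockLeft (I : Type) [Fintype I] (c : Bool) : IsCP (blockLeft I c) :=
  isCP_of_submatrix (fun i => (c, i)) _ fun _ => rfl

theorem trace_blockLeft_add {I : Type} [Fintype I] (ρ : Op (Bool × I)) :
    (blockLeft I false ρ).trace + (blockLeft I true ρ).trace = ρ.trace := by
  simp only [Matrix.trace, Matrix.diag_apply, Fintype.sum_prod_type, Fintype.sum_bool]
  exact add_comm _ _

section Ideal

variable {A C L : Type} [Fintype A] [Fintype C] [Fintype L] {N : ℕ}

/-- What the simulator and the other party do together: from the memory of the simulator and the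
register `B` they produce the bit `c` and the final content of `B`. -/
def Simulator.respond (σ : Simulator C L N) {B : Type} (F : Fin N → Op (C × B) →ₗ[ℂ] Op (C × B)) :
    Op (σ.Mem × B) →ₗ[ℂ] Op (Bool × B) :=
  tensorId σ.final B ∘ₗ interact σ.step F (Fin.last N) ∘ₗ tensorId σ.first B

theorem Simulator.isChannel_respond (σ : Simulator C L N) {B : Type} [Fintype B]
    {F : Fin N → Op (C × B) →ₗ[ℂ] Op (C × B)} (hF : ∀ i, IsChannel (F i)) :
    IsChannel (σ.respond F) :=
  (isChannel_tensorId σ.final_channel B).comp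
    ((isChannel_interact σ.step_channel hF _).comp (isChannel_tensorId σ.first_channel B))

variable [DecidableEq L]

/-- The unnormalized memory of the simulator for the value `b` of its first bit. -/
def leakBranch (T : Task A L) (σ : Simulator C L N) (b : Bool) : Op σ.Mem :=
  blockLeft σ.Mem b (afterLeak T σ)

/-- The action on `B` for the values `b` and `c` of the bits. -/
def Simulator.branch (σ : Simulator C L N) (T : Task A L) {B : Type}
    (F : Fin N → Op (C × B) →ₗ[ℂ] Op (C × B)) (b c : Bool) : Op B →ₗ[ℂ] Op B :=
  blockLeft B c ∘ₗ σ.respond F ∘ₗ prepend B (leakBranch T σ b)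

theorem Simulator.isCP_branch (σ : Simulator C L N) (T : Task A L) {B : Type} [Fintype B]
    {F : Fin N → Op (C × B) →ₗ[ℂ] Op (C × B)} (hF : ∀ i, IsChannel (F i)) (b c : Bool) :
    IsCP (σ.branch T F b c) :=
  (isCP_blockLeft B c).comp ((σ.isChannel_respond hF).1.comp
    (isCP_prepend ((isCP_blockLeft σ.Mem b).map_posSemidef (isState_afterLeak T σ).1)))

/-- Summing over `c` recovers the trace of the trace-preserving `respond`; summing over `b` recovers
the unit trace of `afterLeak`. With positivity, this makes any partial sum of branches trace
non-increasing. -/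
theorem Simulator.trace_branch (σ : Simulator C L N) (T : Task A L) {B : Type} [Fintype B]
    {F : Fin N → Op (C × B) →ₗ[ℂ] Op (C × B)} (hF : ∀ i, IsChannel (F i)) (ρ : Op B) :
    ∑ b : Bool, ∑ c : Bool, (σ.branch T F b c ρ).trace = ρ.trace := by
  have h1 : ∀ b, (σ.branch T F b true ρ).trace + (σ.branch T F b false ρ).trace =
      ρ.trace * (leakBranch T σ b).trace := fun b => by
    rw [add_comm, ← trace_prepend, ← (σ.isChannel_respond hF).2]
    exact trace_blockLeft_add _
  have h2 : (leakBranch T σ true).trace + (leakBranch T σ false).trace = 1 := by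
    rw [add_comm, ← (isState_afterLeak T σ).2]
    exact trace_blockLeft_add _
  rw [Fintype.sum_bool, Fintype.sum_bool, Fintype.sum_bool, h1, h1, ← mul_add, h2, mul_one]

/-- The ideal resource with the simulator acts on `AB` as a mixture of products. -/
theorem Simulator.run_comb [DecidableEq A] (σ : Simulator C L N) (T : Task A L) {B : Type}
    (F : Fin N → Op (C × B) →ₗ[ℂ] Op (C × B)) :
    (σ.comb T).run F =
      ∑ b : Bool, ∑ c : Bool, tensorMap (if b && c then T.errMap else T.U) (σ.branch T F b c) := by
  refine LinearMap.ext fun ρ => ?_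
  ext ⟨a, x⟩ ⟨a', x'⟩
  -- The spectator is `A × Bool`: the stored input and the stored bit. Only blocks diagonal in `b`
  -- and `c` enter the output, while `y` and `y'` are arbitrary.
  have key : ∀ (b c : Bool) (y y' : A),
      idTensor (A × Bool) σ.final (assoc (A × Bool) σ.Mem C (Matrix.of fun i i' =>
        interact (σ.comb T).step F (Fin.last N) (tensorId (σ.comb T).start B ρ) (i, x) (i', x')))
        ((y, b), c) ((y', b), c) =
      σ.branch T F b c (Matrix.of fun i i' => ρ (y, i) (y', i')) x x' := by
    intro b c y y'
    have h := interact_withSpectator σ.step F (A × Bool) (Fin.last N)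
      (tensorId (σ.comb T).start B ρ) (y, b) (y', b)
    exact congrArg (fun X => tensorId σ.final B X (c, x) (c, x')) h
  simp only [Comb.run_eq, LinearMap.comp_apply, LinearMap.sum_apply, Matrix.sum_apply]
  have h1 : tensorId (σ.comb T).finish B
      (interact (σ.comb T).step F (Fin.last N) (tensorId (σ.comb T).start B ρ)) (a, x) (a', x') =
      ∑ b : Bool, ∑ c : Bool, (if b && c then T.errMap else T.U) (Matrix.of fun y y' =>
        idTensor (A × Bool) σ.final (assoc (A × Bool) σ.Mem C (Matrix.of fun i i' =>
        interact (σ.comb T).step F (Fin.last N) (tensorId (σ.comb T).start B ρ) (i, x) (i', x')))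
        ((y, b), c) ((y', b), c)) a a' := by
    change T.output _ a a' = _
    simp only [Task.output, LinearMap.sum_apply, Matrix.sum_apply, LinearMap.comp_apply]
    rfl
  rw [h1]
  simp only [key]
  rfl

/-- Composable security implies stand-alone blind verifiability. -/
theorem Secure.blindVerifiable [DecidableEq A] [DecidableEq C] {T : Task A L}
    {π : Protocol A C N} {ε : ℝ} (h : Secure T π ε) : BlindVerifiable T π ε := by
  obtain ⟨σ, hσ⟩ := h
  intro B _ _ F hF
  have htr := fun (ρ : Op B) => congrArg Complex.re (σ.trace_branch T hF ρ)
  have hnn := fun (ρ : Op B) (hρ : ρ.PosSemidef) (b c : Bool) => (Complex.nonneg_iff.mp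
    ((σ.isCP_branch T hF b c).map_posSemidef hρ).trace_nonneg).1
  simp only [Fintype.sum_bool, Complex.add_re] at htr
  -- The flag is output only for `b = c = 1`, so that branch is `Ferr` and the other three form
  -- `Fok`.
  refine ⟨σ.branch T F true false + (σ.branch T F false true + σ.branch T F false false),
    σ.branch T F true true, ⟨?_, fun ρ hρ => ?_⟩, ⟨σ.isCP_branch T hF _ _, fun ρ hρ => ?_⟩, ?_⟩
  · exact (σ.isCP_branch T hF _ _).add ((σ.isCP_branch T hF _ _).add (σ.isCP_branch T hF _ _))
  · simp only [LinearMap.add_apply, Matrix.trace_add, Complex.add_re]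
    linarith [htr ρ, hnn ρ hρ true true]
  · linarith [htr ρ, hnn ρ hρ true false, hnn ρ hρ false true, hnn ρ hρ false false]
  have hrun : tensorMap T.U (σ.branch T F true false +
      (σ.branch T F false true + σ.branch T F false false)) +
      tensorMap T.errMap (σ.branch T F true true) = (σ.comb T).run F := by
    have hadd : ∀ G G' : Op B →ₗ[ℂ] Op B,
        tensorMap T.U (G + G') = tensorMap T.U G + tensorMap T.U G' := fun G G' => by
      rw [tensorMap, tensorMap, tensorMap, ← LinearMap.comp_add]
      rfl
    rw [Simulator.run_comb, hadd, hadd]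
    simp only [Fintype.sum_bool, Bool.and_true, Bool.and_false, if_true, Bool.false_eq_true, if_false]
    abel
  rw [hrun]
  refine le_trans ?_ hσ
  refine iSup_le fun R => iSup_le fun _ => iSup_le fun _ => iSup_le fun ρ => iSup_le fun hρ => ?_
  have hD : ∀ i, IsChannel (withReference R (F i)) := fun i => isChannel_withReference R (hF i)
  have hρ' : IsState (assoc A B R ρ) := isChannel_assoc.map_state hρ
  -- The distinguisher keeps `B × R` and attacks with `F` alone, leaving the reference `R` idle.
  refine le_trans ?_ (le_iSup_of_le (B × R) (le_iSup_of_le inferInstance (le_iSup_of_le inferInstance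
    (le_iSup_of_le _ (le_iSup_of_le hD (le_iSup_of_le _ (le_iSup_of_le hρ' le_rfl)))))))
  rw [Comb.tensorId_run, Comb.tensorId_run]
  exact EReal.coe_le_coe_iff.mpr (isChannel_assoc_symm.traceDist_le
    ((π.comb.isChannel_run hD).map_state hρ').1.isHermitian
    (((σ.comb T).isChannel_run hD).map_state hρ').1.isHermitian)

end Ideal

/-! ### Measuring the error flag -/

section Measure

variable {I J : Type} [Fintype I] [Fintype J]

/-- The map `ρ ↦ V ρ V†`. -/
def conj (V : Op I) : Op I →ₗ[ℂ] Op I :=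
  LinearMap.mulRight ℂ V.conjTranspose ∘ₗ LinearMap.mulLeft ℂ V

theorem conj_apply (V ρ : Op I) : conj V ρ = V * ρ * V.conjTranspose := rfl

theorem isCP_conj (V : Op I) : IsCP (conj V) := by
  classical
  intro X _ ρ hρ
  have h : tensorId (conj V) X ρ = (V ⊗ₖ (1 : Op X)) * ρ * (V ⊗ₖ (1 : Op X)).conjTranspose := by
    ext ⟨i, x⟩ ⟨i', x'⟩
    simp [tensorId, conj_apply, Matrix.mul_apply, Fintype.sum_prod_type, Matrix.one_apply,
      apply_ite]
  rw [h]
  exact hρ.mul_mul_conjTranspose_same _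

/-- The map that discards its input and prepares `σ`. -/
def discardPrepare (I : Type) [Fintype I] (σ : Op J) : Op I →ₗ[ℂ] Op J :=
  (Matrix.traceLinearMap I ℂ ℂ).smulRight σ

theorem isCP_discardPrepare {σ : Op J} (hσ : σ.PosSemidef) : IsCP (discardPrepare I σ) := by
  intro X _ ρ hρ
  have h : tensorId (discardPrepare I σ) X ρ =
      ∑ i, σ ⊗ₖ ρ.submatrix (fun x : X => (i, x)) (fun x => (i, x)) := by
    ext p q
    simp [tensorId, discardPrepare, Matrix.trace, Matrix.sum_apply, Finset.mul_sum, mul_comm]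
  rw [h]
  exact Matrix.posSemidef_sum _ fun i _ => hσ.kronecker (hρ.submatrix _)

end Measure

theorem IsCP.tensorMap {I J K M : Type} [Fintype I] [Fintype J] [Fintype K] [Fintype M]
    {Φ : Op I →ₗ[ℂ] Op J} {Ψ : Op K →ₗ[ℂ] Op M} (h : IsCP Φ) (h' : IsCP Ψ) :
    IsCP (tensorMap Φ Ψ) :=
  (h.tensorId M).comp (h'.idTensor I)

namespace Task

variable {A L : Type} [Fintype A] (T : Task A L)

/-- The state `|err⟩⟨err|`. -/
def errState : Op A := Matrix.vecMulVec T.err (star T.err)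

theorem posSemidef_errState : T.errState.PosSemidef :=
  Matrix.posSemidef_vecMulVec_self_star T.err

theorem trace_errState : T.errState.trace = 1 := by
  rw [errState, Matrix.trace_vecMulVec, dotProduct_comm, T.err_norm]

theorem isState_errState : IsState T.errState := ⟨T.posSemidef_errState, T.trace_errState⟩

theorem errState_mul_self : T.errState * T.errState = T.errState := by
  rw [errState, Matrix.vecMulVec_mul_vecMulVec, T.err_norm, one_smul]

theorem U_mul_errState {ρ : Op A} (hρ : IsState ρ) : T.U ρ * T.errState = 0 := by
  rw [errState, Matrix.mul_vecMulVec, T.U_orthogonal_err ρ hρ, Matrix.zero_vecMulVec]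

theorem errMap_apply (ρ : Op A) : T.errMap ρ = ρ.trace • T.errState := rfl

variable [DecidableEq A]

/-- The projection to the error flag or to its orthogonal complement. -/
def proj (c : Bool) : Op A := if c then T.errState else 1 - T.errState

theorem conjTranspose_proj (c : Bool) : (T.proj c).conjTranspose = T.proj c := by
  have h : T.errState.conjTranspose = T.errState := T.posSemidef_errState.isHermitian
  cases c <;> simp [proj, h]

theorem proj_mul_self (c : Bool) : T.proj c * T.proj c = T.proj c := by
  cases c <;> simp [proj, mul_sub, sub_mul, T.errState_mul_self]

/-- The measurement of whether the error flag is raised. -/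
def measure : Op A →ₗ[ℂ] Op Bool :=
  ∑ c : Bool, discardPrepare A (Matrix.single c c 1) ∘ₗ conj (T.proj c)

theorem trace_conj_proj (c : Bool) (ρ : Op A) :
    (conj (T.proj c) ρ).trace = (ρ * T.proj c).trace := by
  rw [conj_apply, conjTranspose_proj, Matrix.trace_mul_comm, ← mul_assoc, proj_mul_self,
    Matrix.trace_mul_comm]

theorem measure_apply (ρ : Op A) :
    T.measure ρ = ∑ c : Bool, (ρ * T.proj c).trace • Matrix.single c c 1 := by
  simp only [measure, LinearMap.sum_apply, ← trace_conj_proj]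
  rfl

theorem measure_apply_diag (ρ : Op A) (c : Bool) :
    T.measure ρ c c = (ρ * T.proj c).trace := by
  rw [measure_apply]
  cases c <;> simp

theorem isChannel_measure : IsChannel T.measure := by
  constructor
  · have h : ∀ c : Bool, IsCP (discardPrepare A (Matrix.single c c (1 : ℂ)) ∘ₗ conj (T.proj c)) :=
      fun c => (isCP_discardPrepare (isState_single c).1).comp (isCP_conj _)
    rw [measure, Fintype.sum_bool]
    exact (h true).add (h false)
  · intro ρ
    rw [measure_apply]
    simp [proj, mul_sub]

/-- Here orthogonality of the flag to the outputs of `U` enters: the outcome is certain, which is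
why reading the flag adds no error. -/
theorem measure_U {ρ : Op A} (hρ : IsState ρ) (c : Bool) :
    T.measure (T.U ρ) c c = if c then 0 else 1 := by
  rw [measure_apply_diag]
  cases c <;> simp [proj, mul_sub, T.U_mul_errState hρ, T.U_channel.2, hρ.2]

theorem measure_errMap {ρ : Op A} (hρ : IsState ρ) (c : Bool) :
    T.measure (T.errMap ρ) c c = if c then 1 else 0 := by
  rw [measure_apply_diag, errMap_apply, hρ.2, one_smul]
  cases c <;> simp [proj, mul_sub, T.errState_mul_self, T.trace_errState]

end Task

/-! ### The simulator, and blind verifiability implies security -/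

theorem isChannel_prodComm (I J : Type) [Fintype I] [Fintype J] : IsChannel
    (Matrix.reindexLinearEquiv ℂ ℂ (Equiv.prodComm I J) (Equiv.prodComm I J)).toLinearMap :=
  ⟨isCP_of_submatrix (Equiv.prodComm I J).symm _ fun _ => rfl, fun ρ =>
    Equiv.sum_comp (Equiv.prodComm I J).symm fun x => ρ x x⟩

/-- The joint input `ρ` of the ideal resource and the distinguisher, with the input of the simulated
protocol. -/
def Task.simulationInput {A L : Type} [Fintype A] (T : Task A L) {R : Type} (ρ : Op (A × R)) : Op ((A × R) × A) :=
  (assoc A R A).symm (prepend (R × A) T.errState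
    (Matrix.reindexLinearEquiv ℂ ℂ (Equiv.prodComm A R) (Equiv.prodComm A R) ρ))

theorem Task.isState_simulationInput {A L : Type} [Fintype A] (T : Task A L) {R : Type} [Fintype R] {ρ : Op (A × R)}
    (hρ : IsState ρ) : IsState (T.simulationInput ρ) := by
  refine isChannel_assoc_symm.map_state ?_
  have h := (isChannel_prodComm A R).map_state hρ
  refine ⟨(isCP_prepend T.posSemidef_errState).map_posSemidef h.1, ?_⟩
  rw [trace_prepend, T.trace_errState, mul_one]
  exact h.2

section Simulation

variable {A C L : Type} [Fintype A] [DecidableEq A] [Fintype C] [DecidableEq C] {N : ℕ}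

/-- Measure the error flag on the first register and depending on the outcome apply `U` or `E^err`
to the third. -/
def Task.correct (T : Task A L) (R : Type) : Op ((A × R) × A) →ₗ[ℂ] Op (A × R) :=
  ∑ c : Bool, tensorId (if c then T.errMap else T.U) R ∘ₗ
    (Matrix.reindexLinearEquiv ℂ ℂ (Equiv.prodComm R A) (Equiv.prodComm R A)).toLinearMap ∘ₗ
    blockLeft (R × A) c ∘ₗ tensorId T.measure (R × A) ∘ₗ (assoc A R A).toLinearMap

theorem Task.isChannel_correct (T : Task A L) (R : Type) [Fintype R] :
    IsChannel (T.correct R) := by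
  have hW : ∀ c : Bool, IsChannel (tensorId (if c then T.errMap else T.U) R ∘ₗ
      (Matrix.reindexLinearEquiv ℂ ℂ (Equiv.prodComm R A) (Equiv.prodComm R A)).toLinearMap) :=
    fun c => by
      refine (isChannel_tensorId ?_ R).comp (isChannel_prodComm R A)
      split_ifs
      exacts [isChannel_errMap T, T.U_channel]
  have hm : IsChannel (tensorId T.measure (R × A) ∘ₗ (assoc A R A).toLinearMap) :=
    (isChannel_tensorId T.isChannel_measure _).comp isChannel_assoc
  constructor
  · have h := fun c => (hW c).1.comp ((isCP_blockLeft (R × A) c).comp hm.1)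
    rw [correct, Fintype.sum_bool]
    exact (h true).add (h false)
  · intro ρ
    rw [← hm.2, ← trace_blockLeft_add, ← (hW false).2, ← (hW true).2, add_comm,
      ← Matrix.trace_add, correct, Fintype.sum_bool]
    rfl

/-- In `(A × R) × A` the first register holds the dummy input and the last the true one. On the
product form, the outcome `c` read from the first register selects `Fok` or `Ferr` on `R`, and
`correct` then applies the matching `U` or `E^err` to the true input. -/
theorem Task.correct_product (T : Task A L) {R : Type} (Fok Ferr : Op R →ₗ[ℂ] Op R)
    (ρ : Op (A × R)) :
    T.correct R (tensorId (tensorMap T.U Fok + tensorMap T.errMap Ferr) A (T.simulationInput ρ)) =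
      (tensorMap T.U Fok + tensorMap T.errMap Ferr) ρ := by
  -- The dummy register starts uncorrelated with the rest, so `Φ` sees only `errState` and `F`
  -- contributes a scalar for each block.
  have hprod : ∀ (Φ : Op A →ₗ[ℂ] Op A) (F : Op R →ₗ[ℂ] Op R) (x x' : A) (r r' : R),
      (Matrix.of fun y y' : A => tensorMap Φ F (Matrix.of fun i i' =>
        T.simulationInput ρ (i, x) (i', x')) (y, r) (y', r')) =
      F (Matrix.of fun s s' => ρ (x, s) (x', s')) r r' • Φ T.errState := by
    intro Φ F x x' r r'
    rw [← map_smul]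
    have h : ∀ y y', (Matrix.of fun s s' => T.simulationInput ρ ((y, s), x) ((y', s'), x')) =
        T.errState y y' • Matrix.of fun s s' => ρ (x, s) (x', s') := fun y y' => by
      ext s s'
      exact mul_comm _ _
    have h' : (Matrix.of fun y y' => F (Matrix.of fun s s' =>
        T.simulationInput ρ ((y, s), x) ((y', s'), x')) r r') =
        F (Matrix.of fun s s' => ρ (x, s) (x', s')) r r' • T.errState := by
      ext y y'
      rw [Matrix.of_apply, h, map_smul]
      exact mul_comm _ _
    exact congrArg Φ h'
  have key : ∀ (c : Bool) (x x' : A) (r r' : R),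
      T.measure (Matrix.of fun y y' : A => tensorId (tensorMap T.U Fok + tensorMap T.errMap Ferr) A
        (T.simulationInput ρ) ((y, r), x) ((y', r'), x')) c c =
      (if c then Ferr else Fok) (Matrix.of fun s s' => ρ (x, s) (x', s')) r r' := by
    intro c x x' r r'
    have h : (Matrix.of fun y y' : A => tensorId (tensorMap T.U Fok + tensorMap T.errMap Ferr) A
        (T.simulationInput ρ) ((y, r), x) ((y', r'), x')) = _ :=
      congrArg₂ (· + ·) (hprod T.U Fok x x' r r') (hprod T.errMap Ferr x x' r r')
    rw [h, map_add, map_smul, map_smul, Matrix.add_apply, Matrix.smul_apply, Matrix.smul_apply,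
      T.measure_U T.isState_errState, T.measure_errMap T.isState_errState]
    cases c <;> simp
  have hsum : ∀ c : Bool, (tensorId (if c then T.errMap else T.U) R ∘ₗ
      (Matrix.reindexLinearEquiv ℂ ℂ (Equiv.prodComm R A) (Equiv.prodComm R A)).toLinearMap ∘ₗ
      blockLeft (R × A) c ∘ₗ tensorId T.measure (R × A) ∘ₗ (assoc A R A).toLinearMap)
      (tensorId (tensorMap T.U Fok + tensorMap T.errMap Ferr) A (T.simulationInput ρ)) =
      tensorMap (if c then T.errMap else T.U) (if c then Ferr else Fok) ρ := by
    intro c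
    refine congrArg (tensorId (if c then T.errMap else T.U) R) ?_
    ext ⟨x, r⟩ ⟨x', r'⟩
    exact key c x x' r r'
  rw [correct, LinearMap.sum_apply, Fintype.sum_bool, hsum, hsum]
  exact add_comm _ _

theorem traceDist_le_of_diamondDist_le {I J : Type} [Fintype I] [Fintype J] [DecidableEq J]
    {Φ Ψ : Op I →ₗ[ℂ] Op J} {ε : ℝ} (h : diamondDist Φ Ψ ≤ (ε : EReal)) {R : Type} [Fintype R]
    [DecidableEq R] {ρ : Op (I × R)} (hρ : IsState ρ) :
    traceDist (tensorId Φ R ρ) (tensorId Ψ R ρ) ≤ ε := by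
  refine EReal.coe_le_coe_iff.mp (le_trans ?_ h)
  exact le_iSup_of_le R (le_iSup_of_le inferInstance (le_iSup_of_le inferInstance
    (le_iSup_of_le ρ (le_iSup_of_le hρ le_rfl))))

/-- This is the case of a trivial reference `Unit`, which is adjoined and then traced out. -/
theorem traceDist_apply_le_of_diamondDist_le {I J : Type} [Fintype I] [Fintype J] [DecidableEq J]
    {Φ Ψ : Op I →ₗ[ℂ] Op J} (hΦ : IsCP Φ) (hΨ : IsCP Ψ) {ε : ℝ}
    (h : diamondDist Φ Ψ ≤ (ε : EReal)) {ρ : Op I} (hρ : IsState ρ) :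
    traceDist (Φ ρ) (Ψ ρ) ≤ ε := by
  have hρ' : IsState (append I (1 : Op Unit) ρ) :=
    (isChannel_append ⟨Matrix.PosSemidef.one, by simp⟩).map_state hρ
  have h1 : ∀ Θ : Op I →ₗ[ℂ] Op J,
      Θ ρ = traceRight J Unit (tensorId Θ Unit (append I (1 : Op Unit) ρ)) := fun Θ => by
    ext j j'
    have h2 : (Matrix.of fun i i' => append I (1 : Op Unit) ρ (i, ()) (i', ())) = ρ := by
      ext i i'
      simp [append]
    change _ = ∑ k : Unit, Θ (Matrix.of fun i i' => append I (1 : Op Unit) ρ (i, k) (i', k)) j j'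
    rw [Fintype.sum_unique]
    exact congrArg (fun X => Θ X j j') h2.symm
  rw [h1 Φ, h1 Ψ]
  exact (isChannel_traceRight.traceDist_le (hΦ _ _ hρ'.1).isHermitian
    (hΨ _ _ hρ'.1).isHermitian).trans (traceDist_le_of_diamondDist_le h hρ')

variable [Fintype L]

/-- The simulator that runs Alice's protocol on a fixed input and reports whether the output is the
error flag. -/
def Protocol.simulator (π : Protocol A C N) (T : Task A L) : Simulator C L N where
  Mem := A
  -- The bit is always `b = 1`, so that `c` decides the output. The dummy input could be any state;
  -- `errState` is one that the task supplies.
  init := T.errState ⊗ₖ Matrix.single true true 1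
  init_state := ⟨T.posSemidef_errState.kronecker (isState_single true).1, by
    rw [Matrix.trace_kronecker, T.trace_errState, (isState_single true).2, one_mul]⟩
  receiveLeak := traceRight A L
  receiveLeak_channel := isChannel_traceRight
  first := π.comb.start
  first_channel := π.comb.start_channel
  step := π.comb.step
  step_channel := π.comb.step_channel
  final := T.measure ∘ₗ traceRight A C
  final_channel := T.isChannel_measure.comp isChannel_traceRight

theorem Protocol.respond_simulator (π : Protocol A C N) (T : Task A L) {B : Type}
    (F : Fin N → Op (C × B) →ₗ[ℂ] Op (C × B)) :
    (π.simulator T).respond F = tensorId T.measure B ∘ₗ π.comb.run F := by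
  rw [Comb.run_eq]
  rfl

variable [DecidableEq L]

theorem Protocol.leakBranch_simulator (π : Protocol A C N) (T : Task A L) (b : Bool) :
    leakBranch T (π.simulator T) b = if b then T.errState else 0 := by
  have h1 : block A true (T.errState ⊗ₖ Matrix.single true true 1) = T.errState := by
    ext i j
    change T.errState i j * Matrix.single true true 1 true true = _
    simp
  have h0 : block A false (T.errState ⊗ₖ Matrix.single true true 1) = 0 := by
    ext i j
    change T.errState i j * Matrix.single true true 1 false false = _
    simp
  have h2 : traceRight A L (append A (Matrix.single T.leak T.leak 1) T.errState) = T.errState := by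
    ext i j; simp [traceRight, append, Matrix.single_apply]
  have h3 : Matrix.single false false 1 ⊗ₖ block A false (T.errState ⊗ₖ Matrix.single true true 1) +
      Matrix.single true true 1 ⊗ₖ traceRight A L (append A (Matrix.single T.leak T.leak 1)
        (block A true (T.errState ⊗ₖ Matrix.single true true 1))) =
      Matrix.single true true (1 : ℂ) ⊗ₖ T.errState := by
    rw [h0, h1, h2, Matrix.kronecker_zero, zero_add]
  refine (congrArg (blockLeft A b) h3).trans ?_
  ext i j
  change (Matrix.single true true 1 : Op Bool) b b * T.errState i j = _
  cases b <;> simp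

/-- As `b = 1` always, two of the four branches vanish. The other two are the attack on the dummy
input, with the true input as an idle reference, followed by the two terms of `correct`. -/
theorem Protocol.run_simulator (π : Protocol A C N) (T : Task A L) {R : Type}
    (D : Fin N → Op (C × R) →ₗ[ℂ] Op (C × R)) (ρ : Op (A × R)) :
    ((π.simulator T).comb T).run D ρ =
      T.correct R (tensorId (π.comb.run D) A (T.simulationInput ρ)) := by
  have h0 : ∀ c, (π.simulator T).branch T D false c = 0 := fun c => by
    have h : prepend R (leakBranch T (π.simulator T) false) = 0 := by
      rw [leakBranch_simulator]
      ext X i j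
      exact mul_zero _
    rw [Simulator.branch, h, LinearMap.comp_zero, LinearMap.comp_zero]
  have h1 : ∀ c, (π.simulator T).branch T D true c =
      blockLeft R c ∘ₗ (tensorId T.measure R ∘ₗ π.comb.run D) ∘ₗ prepend R T.errState := fun c => by
    -- `errState` is written as a conditional so that `leakBranch_simulator` can be used backwards.
    rw [← respond_simulator, ← if_pos (c := true = true) (t := T.errState) (e := 0) rfl,
      ← leakBranch_simulator π T true]
    rfl
  have h2 : ∀ Φ : Op A →ₗ[ℂ] Op A, tensorMap Φ (0 : Op R →ₗ[ℂ] Op R) = 0 := fun Φ => by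
    have h : idTensor A (0 : Op R →ₗ[ℂ] Op R) = 0 := rfl
    rw [tensorMap, h, LinearMap.comp_zero]
  rw [Simulator.run_comb, Task.correct]
  simp only [Fintype.sum_bool, h0, h1, h2, add_zero]
  rfl

/-- Stand-alone blind verifiability implies composable security. -/
theorem BlindVerifiable.secure {T : Task A L} {π : Protocol A C N} {ε : ℝ}
    (h : BlindVerifiable T π ε) : Secure T π (2 * ε) := by
  refine ⟨π.simulator T, ?_⟩
  refine iSup_le fun R => iSup_le fun _ => iSup_le fun _ => iSup_le fun D => iSup_le fun hD =>
    iSup_le fun ρ => iSup_le fun hρ => EReal.coe_le_coe_iff.mpr ?_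
  -- The same `Fok` and `Ferr` serve twice: on the true input `ρ` (`h1`) and on the dummy input with
  -- the true input as reference (`h2`). Each use costs `ε`.
  obtain ⟨Fok, Ferr, hok, herr, hdist⟩ := h R D hD
  have hreal := π.comb.isChannel_run hD
  have hideal : IsCP (tensorMap T.U Fok + tensorMap T.errMap Ferr) :=
    (T.U_channel.1.tensorMap hok.1).add ((isChannel_errMap T).1.tensorMap herr.1)
  have hω := T.isState_simulationInput hρ
  have h1 := traceDist_apply_le_of_diamondDist_le hreal.1 hideal hdist hρ
  have h2 := ((T.isChannel_correct R).traceDist_le (hreal.1 A _ hω.1).isHermitian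
    (hideal A _ hω.1).isHermitian).trans (traceDist_le_of_diamondDist_le hdist hω)
  rw [← π.run_simulator, T.correct_product, traceDist_comm] at h2
  have h3 := traceDist_triangle (hreal.map_state hρ).1.isHermitian
    (hideal.map_posSemidef hρ.1).isHermitian
    ((((π.simulator T).comb T).isChannel_run hD).map_state hρ).1.isHermitian
  linarith

end Simulation

end DQC

theorem theorem1 {A C L : Type} [Fintype A] [DecidableEq A] [Fintype C] [DecidableEq C]
    [Fintype L] [DecidableEq L] {N : ℕ} (T : DQC.Task A L) (π : DQC.Protocol A C N) (ε : ℝ) :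
    (DQC.BlindVerifiable T π ε → DQC.Secure T π (2 * ε)) ∧
      (DQC.Secure T π ε → DQC.BlindVerifiable T π ε) :=
  ⟨DQC.BlindVerifiable.secure, DQC.Secure.blindVerifiable⟩
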